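/- Let $\mathbb K=\mathbb R$ or $\mathbb C$ and $n\ge 3$. Let $\mathcal F$ be any one of the following algebras of functions in $x_1,\dots,x_n$: the germs at $0\in\mathbb K^n$ of $\mathcal C^\infty$ functions ($\mathbb K=\mathbb R$), of real analytic functions ($\mathbb K=\mathbb R$), of holomorphic functions ($\mathbb K=\mathbb C$), or the formal power series over $\mathbb K$. Let $\Omega^k$ denote the corresponding $k$-forms and let $f\in\mathcal F$ satisfy $f(0)=0$ and be of finite codimension, i.e. $\mathcal F/\bigl(\tfrac{\partial f}{\partial x_1},\dots,\tfrac{\partial f}{\partial x_n}\bigr)$ is a finite-dimensional $\mathbb K$-vector space. For $p\in\mathbb Z$ let $H^\bullet_{f,p}(\mathbb K^n)$ be the cohomology of the complex $\Omega^0\to\Omega^1\to\cdots\to\Omega^n$ with differential $d_f^{(p)}\alpha=f\,d\alpha-(k-p)\,df\wedge\alpha$ for $\alpha\in\Omega^k$; in particular $H^0_{f,p}(\mathbb K^n)=\{g\in\mathcal F : f\,dg+p\,g\,df=0\}$. Then: 1. if $p>0$, then $H^0_{f,p}(\mathbb K^n)=\{0\}$; 2. if $p\le 0$, then $H^0_{f,p}(\mathbb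 K^n)=\mathbb K\cdot f^{-p}$. Moreover, let $\Lambda=f\,\frac{\partial}{\partial x_1}\wedge\dots\wedge\frac{\partial}{\partial x_n}$, and let $H^\bullet_{NP}(\mathbb K^n,\Lambda)$ be its Nambu-Poisson cohomology, i.e. the cohomology of the Lie algebroid whose sections are the $(n-1)$-forms and whose anchor is $\alpha\mapsto\#_\Lambda\alpha=i_\alpha\Lambda$; in degree $0$ it is $\{c\in\mathcal F : (\#_\Lambda\alpha)\cdot c=0 \text{ for all }\alpha\in\Omega^{n-1}\}$. Then $H^0_{NP}(\mathbb K^n,\Lambda)$ is the one-dimensional space $\mathbb K\cdot 1$ of constants. -/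

import Mathlib

open Filter Topology
open scoped ContDiff

noncomputable section

namespace NambuPoisson

/-! ## Complexes attached to `f` over a ring of functions

`F` is a commutative `K`-algebra of functions (or formal functions) in `n` coordinates `x₁, …, xₙ`,
and `D i : Derivation K F F` is the partial derivative `∂/∂xᵢ`. Functions are elements of `F`;
vector fields `∑ Xᵢ ∂/∂xᵢ` and `1`-forms `∑ aᵢ dxᵢ` are given by their coefficients
`Fin n → F`. The definitions are applied below to germs of functions and to formal series. -/

section Generic

variable {K F : Type*} [Field K] [CommRing F] [Algebra K F] {n : ℕ}

/-- The ideal `I_f` generated by the partial derivatives of `f`. -/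
def jacobianIdeal (D : Fin n → Derivation K F F) (f : F) : Ideal F :=
  Ideal.span (Set.range fun i => D i f)

/-- `f` is of finite codimension: `Q_f = F / I_f` is a finite dimensional vector space. -/
def FiniteCodim (D : Fin n → Derivation K F F) (f : F) : Prop :=
  Module.Finite K (F ⧸ jacobianIdeal D f)

/-- The differential `d : Ω⁰ → Ω¹`, `g ↦ ∑ᵢ (∂g/∂xᵢ) dxᵢ`. -/
def extDer (D : Fin n → Derivation K F F) : F →ₗ[K] (Fin n → F) :=
  LinearMap.pi fun i => (D i : F →ₗ[K] F)

/-- The operator `α ↦ f dα - (k - p) df ∧ α` in degree `k = 0`, from `Ω⁰` to `Ω¹`. -/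
def twistedDiff (D : Fin n → Derivation K F F) (f : F) (p : ℤ) : F →ₗ[K] (Fin n → F) where
  toFun g := f • extDer D g - ((0 : ℤ) - p) • (g • extDer D f)
  map_add' g h := by
    simp only [map_add, smul_add, add_smul]
    abel
  map_smul' c g := by
    simp only [map_smul, RingHom.id_apply, smul_sub, smul_assoc]
    rw [smul_comm f c, smul_comm _ c (g • extDer D f)]

/-- The space `H⁰_{f,p}`: the `0`-cocycles (there is nothing in degree `-1`, so no nonzero
coboundary in degree `0`). -/
def H0 (D : Fin n → Derivation K F F) (f : F) (p : ℤ) : Submodule K F :=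
  LinearMap.ker (twistedDiff D f p)

/-- The `n`-vector `Λ = f ∂/∂x₁ ∧ ⋯ ∧ ∂/∂xₙ`, as an alternating form on `1`-forms:
`Λ(θ₁, …, θₙ) = f det (θᵢ(∂/∂xⱼ))`. -/
def topVector (n : ℕ) (f : F) : (Fin n → F) [⋀^Fin n]→ₗ[F] F :=
  f • Matrix.detRowAlternating

/-- The vector field `#_Λ α = i_α Λ` for an `(n-1)`-form `α` (an alternating form on vector
fields). It is determined by `i_{θ₁ ∧ ⋯ ∧ θₙ₋₁} Λ = Λ(θ₁, …, θₙ₋₁, •)`; writing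
`α = ∑ α(∂_{s 0}, …, ∂_{s (n-2)}) dx_{s 0} ∧ ⋯ ∧ dx_{s (n-2)}`, the sum running over the strictly
increasing `s`, its `j`-th coefficient is the value on `dxⱼ`. Both `∂ᵢ` and `dxᵢ` have the
coefficient vector `Pi.single i 1`. -/
def sharp (f : F) (α : (Fin n → F) [⋀^Fin (n - 1)]→ₗ[F] F) : Fin n → F := fun j =>
  open Classical in
  ∑ s : Fin (n - 1) → Fin n with StrictMono s,
    α (fun a => Pi.single (s a) 1) *
      topVector n f (fun i =>
        if h : (i : ℕ) < n - 1 then Pi.single (s ⟨i, h⟩) 1 else Pi.single j 1)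

/-- The action of a vector field `X = ∑ Xᵢ ∂/∂xᵢ` on functions, `g ↦ X.g`. -/
def fieldAct (D : Fin n → Derivation K F F) (X : Fin n → F) : F →ₗ[K] F :=
  ∑ i, ((X i • D i : Derivation K F F) : F →ₗ[K] F)

/-- The degree zero part `∂ : C⁰ → C¹` of the cohomology operator of the Lie algebroid of
`(n-1)`-forms with anchor `#_Λ`: `(∂c)(α) = (#_Λ α).c`. -/
def npDiff (D : Fin n → Derivation K F F) (f : F) :
    F →ₗ[K] (((Fin n → F) [⋀^Fin (n - 1)]→ₗ[F] F) → F) :=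
  LinearMap.pi fun α => fieldAct D (sharp f α)

/-- The space `H⁰_NP` of the `n`-vector `Λ = f ∂/∂x₁ ∧ ⋯ ∧ ∂/∂xₙ`: the `0`-cocycles of its
Nambu-Poisson complex (again there are no nonzero coboundaries in degree `0`). -/
def H0NP (D : Fin n → Derivation K F F) (f : F) : Submodule K F :=
  LinearMap.ker (npDiff D f)

end Generic

/-! ## Germs at `0` of functions of class `∞` (smooth) or `ω` (analytic) -/

section Germs

variable (𝕜 : Type*) [RCLike 𝕜] (n : ℕ) (r : WithTop ℕ∞)

instance germAlgebra : Algebra 𝕜 (Germ (𝓝 (0 : Fin n → 𝕜)) 𝕜) :=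
  Algebra.ofModule
    (fun _ a b => Germ.inductionOn a fun _ => Germ.inductionOn b fun _ =>
      congrArg _ (funext fun _ => smul_mul_assoc _ _ _))
    (fun _ a b => Germ.inductionOn a fun _ => Germ.inductionOn b fun _ =>
      congrArg _ (funext fun _ => mul_smul_comm _ _ _))

/-- The algebra of germs at `0` of functions on `𝕜ⁿ` which are of class `C^r` over `𝕜` on a
neighbourhood of `0`. -/
def FunGerm : Subalgebra 𝕜 (Germ (𝓝 (0 : Fin n → 𝕜)) 𝕜) where
  carrier := {φ | ∃ u : (Fin n → 𝕜) → 𝕜, (∀ᶠ x in 𝓝 0, ContDiffAt 𝕜 r u x) ∧ φ = (u : Germ _ 𝕜)}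
  mul_mem' := by
    rintro _ _ ⟨u, hu, rfl⟩ ⟨v, hv, rfl⟩
    exact ⟨u * v, by filter_upwards [hu, hv] with x h1 h2 using h1.mul h2, rfl⟩
  add_mem' := by
    rintro _ _ ⟨u, hu, rfl⟩ ⟨v, hv, rfl⟩
    exact ⟨u + v, by filter_upwards [hu, hv] with x h1 h2 using h1.add h2, rfl⟩
  algebraMap_mem' c :=
    ⟨fun _ => c, Eventually.of_forall fun _ => contDiffAt_const, by
      rw [Algebra.algebraMap_eq_smul_one]
      exact congrArg _ (funext fun _ => by simp)⟩

variable {𝕜 n r}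

/-- The partial derivative of a germ. -/
def germPartial (i : Fin n) (φ : Germ (𝓝 (0 : Fin n → 𝕜)) 𝕜) : Germ (𝓝 (0 : Fin n → 𝕜)) 𝕜 :=
  Quotient.liftOn' φ
    (fun u => ((fun x => fderiv 𝕜 u x (Pi.single i 1) : (Fin n → 𝕜) → 𝕜) : Germ _ 𝕜))
    (fun _ _ h => Germ.coe_eq.2 (by
      filter_upwards [EventuallyEq.fderiv (𝕜 := 𝕜) h] with x hx
      rw [hx]))

theorem germPartial_coe (i : Fin n) (u : (Fin n → 𝕜) → 𝕜) :
    germPartial i (u : Germ (𝓝 (0 : Fin n → 𝕜)) 𝕜) =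
      ((fun x => fderiv 𝕜 u x (Pi.single i 1) : (Fin n → 𝕜) → 𝕜) : Germ _ 𝕜) := rfl

theorem add_one_le_of_infty_le (hr : ∞ ≤ r) : r + 1 ≤ r := by
  rcases r with _ | r
  · exact le_top
  · have : r = ⊤ := top_le_iff.1 (WithTop.coe_le_coe.1 hr)
    subst this
    exact le_rfl

theorem germPartial_mem (hr : ∞ ≤ r) (i : Fin n) {φ : Germ (𝓝 (0 : Fin n → 𝕜)) 𝕜}
    (hφ : φ ∈ FunGerm 𝕜 n r) : germPartial i φ ∈ FunGerm 𝕜 n r := by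
  obtain ⟨u, hu, rfl⟩ := hφ
  refine ⟨_, ?_, germPartial_coe i u⟩
  filter_upwards [hu] with x hx
  exact (hx.fderiv_right (add_one_le_of_infty_le hr)).clm_apply contDiffAt_const

theorem ne_zero_of_infty_le (hr : ∞ ≤ r) : r ≠ 0 := by
  rintro rfl
  exact absurd hr (by simp)

/-- The partial derivative `∂/∂xᵢ` as a derivation of the algebra of germs of class `C^r`,
where `r` is `∞` or `ω`. -/
def germDer (hr : ∞ ≤ r) (i : Fin n) : Derivation 𝕜 (FunGerm 𝕜 n r) (FunGerm 𝕜 n r) :=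
  Derivation.mk'
    { toFun := fun φ => ⟨germPartial i φ.1, germPartial_mem hr i φ.2⟩
      map_add' := by
        rintro ⟨_, u, hu, rfl⟩ ⟨_, v, hv, rfl⟩
        refine Subtype.ext (Germ.coe_eq.2 ?_)
        filter_upwards [hu, hv] with x h1 h2
        have h1 := h1.differentiableAt (ne_zero_of_infty_le hr)
        have h2 := h2.differentiableAt (ne_zero_of_infty_le hr)
        change fderiv 𝕜 (u + v) x _ = fderiv 𝕜 u x _ + fderiv 𝕜 v x _
        rw [fderiv_add h1 h2]
        rfl
      map_smul' := by
        rintro c ⟨_, u, hu, rfl⟩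
        refine Subtype.ext (Germ.coe_eq.2 ?_)
        filter_upwards [hu] with x h1
        have h1 := h1.differentiableAt (ne_zero_of_infty_le hr)
        change fderiv 𝕜 (c • u) x _ = c • fderiv 𝕜 u x _
        rw [fderiv_const_smul h1]
        rfl }
    (by
      rintro ⟨_, u, hu, rfl⟩ ⟨_, v, hv, rfl⟩
      refine Subtype.ext (Germ.coe_eq.2 ?_)
      filter_upwards [hu, hv] with x h1 h2
      have h1 := h1.differentiableAt (ne_zero_of_infty_le hr)
      have h2 := h2.differentiableAt (ne_zero_of_infty_le hr)
      change fderiv 𝕜 (u * v) x _ = u x * fderiv 𝕜 v x _ + v x * fderiv 𝕜 u x _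
      rw [fderiv_mul h1 h2]
      rfl)

end Germs

end NambuPoisson

end

/-!
The proof uses only that the ring of functions is reduced and of characteristic zero, that `x₁` and
`x₂` form a regular sequence in it, that the functions with vanishing differential are the
constants, and that a function not vanishing at `0` is invertible.

Let `J` be the Jacobian ideal of `f`. As `F / J` is finite dimensional, `xᵢ` is algebraic modulo
`J`; writing its equation as `xᵢ ^ N * Q(xᵢ)` with `Q(0) ≠ 0` gives `xᵢ ^ N ∈ J`
(`exists_pow_mem_jacobianIdeal`). Two consequences follow.

* `f` is not a zero divisor: `f u = 0` implies `u² ∂f/∂xᵢ = 0` for all `i`, hence `x₁ ^ N u² = 0`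
  (`eq_zero_of_mul_eq_zero_of_pow_mem`).
* If `f` divides `g ∂f/∂xᵢ` for all `i`, then it divides `x₁ ^ N g` and `x₂ ^ M g`, hence `g`, since
  `x₁ ^ N, x₂ ^ M` is a regular sequence (`dvd_of_forall_dvd_mul_partial`).

Let `f dg + p g df = 0`. For `p > 0`, `g f ^ p` has zero differential, so it is a constant, which is
zero because `f` is not invertible (`H0_eq_bot_of_pos`). For `p < 0` the second consequence gives
`g = f h`, and `h` satisfies the equation for `p + 1`; after `-p` steps one reaches `p = 0`, where
the differential of the quotient vanishes (`exists_eq_smul_pow_of_mem_H0`). For the Nambu-Poisson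
complex, the anchor takes `i_{∂ⱼ} (dx₁ ∧ ⋯ ∧ dxₙ)` to a nonzero multiple of `f ∂/∂xⱼ`, so a cocycle
has zero differential (`partial_eq_zero_of_mem_H0NP`).

For smooth germs, the regularity of the sequence `x₁, x₂` is Hadamard's lemma
(`coordGerm_dvd_mk`), proved by smoothness of an integral depending on a parameter
(`contDiffOn_integral_clm_apply_comp`). Analytic germs are embedded in the smooth ones, and the
divisions are carried out there: the conclusion `g = c f ^ (-p)` can be checked after the embedding
(`cohomology_zero_of_regular_sequence`).
-/

noncomputable section

namespace NambuPoisson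

/-! ### Cocycles of degree zero over an abstract ring of functions -/

section Abstract

variable {K F : Type*} [Field K] [CommRing F] [Algebra K F] {n : ℕ}
  {D : Fin n → Derivation K F F} {f : F}

theorem mem_H0_iff {p : ℤ} {g : F} :
    g ∈ H0 D f p ↔ ∀ i, f * D i g + p * (g * D i f) = 0 := by
  rw [H0, LinearMap.mem_ker, funext_iff]
  refine forall_congr' fun i => ?_
  simp [twistedDiff, extDer, zsmul_eq_mul, mul_left_comm]

/-- For `p > 0` a cocycle `g` satisfies `d (g f ^ p) = 0`, so `g f ^ p` is a constant; the constant
is `0` since `f` is not invertible. -/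
theorem H0_eq_bot_of_pos (hker : ∀ g : F, (∀ i, D i g = 0) → ∃ c : K, g = algebraMap K F c)
    (hf : ∀ u, f * u = 0 → u = 0) (hfu : ¬ IsUnit f) {p : ℤ} (hp : 0 < p) : H0 D f p = ⊥ := by
  obtain ⟨m, rfl⟩ : ∃ m : ℕ, p = m + 1 := ⟨(p - 1).toNat, by omega⟩
  rw [eq_bot_iff]
  intro g hg
  rw [mem_H0_iff] at hg
  obtain ⟨c, hc⟩ := hker (g * f ^ (m + 1)) fun i => by
    rw [Derivation.leibniz, Derivation.leibniz_pow]
    simp only [smul_eq_mul, nsmul_eq_mul, Nat.add_sub_cancel]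
    have := hg i
    push_cast at this ⊢
    linear_combination f ^ m * this
  have hc0 : c = 0 := by
    by_contra h
    refine hfu (isUnit_of_dvd_unit (y := algebraMap K F c) ⟨g * f ^ m, ?_⟩
      ((IsUnit.mk0 c h).map _))
    rw [← hc]
    ring
  rw [hc0, map_zero] at hc
  have key : ∀ k : ℕ, g * f ^ k = 0 → g = 0 := by
    intro k
    induction k with
    | zero => simp
    | succ k ih => exact fun h => ih (hf _ (by rw [← h]; ring))
  exact key _ hc

/-- For `p ≤ 0` a cocycle is divisible by `f` unless `p = 0`, and the quotient is a cocycle for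
`p + 1`. -/
theorem exists_eq_smul_pow_of_mem_H0 [CharZero K]
    (hker : ∀ g : F, (∀ i, D i g = 0) → ∃ c : K, g = algebraMap K F c)
    (hf : ∀ u, f * u = 0 → u = 0) (hdiv : ∀ g, (∀ i, f ∣ g * D i f) → f ∣ g) (k : ℕ) :
    ∀ g ∈ H0 D f (-k), ∃ c : K, g = c • f ^ k := by
  induction k with
  | zero =>
    intro g hg
    rw [mem_H0_iff] at hg
    obtain ⟨c, hc⟩ := hker g fun i => hf _ (by simpa using hg i)
    exact ⟨c, by rw [hc, pow_zero, Algebra.algebraMap_eq_smul_one]⟩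
  | succ k ih =>
    intro g hg
    rw [mem_H0_iff] at hg
    obtain ⟨h, rfl⟩ := hdiv g fun i => by
      have hk : IsUnit ((k + 1 : ℕ) : F) := by
        rw [← map_natCast (algebraMap K F)]
        exact (IsUnit.mk0 _ (Nat.cast_ne_zero.2 k.succ_ne_zero)).map _
      rw [← hk.dvd_mul_left]
      refine ⟨D i g, ?_⟩
      have := hg i
      push_cast at this ⊢
      linear_combination -this
    obtain ⟨c, hc⟩ := ih h (mem_H0_iff.2 fun i => hf _ (by
      have := hg i
      rw [Derivation.leibniz] at this
      simp only [smul_eq_mul] at this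
      push_cast at this ⊢
      linear_combination this))
    exact ⟨c, by rw [hc, pow_succ, mul_smul_comm, mul_comm]⟩

theorem pow_mem_H0 (k : ℕ) : f ^ k ∈ H0 D f (-k) := by
  refine mem_H0_iff.2 fun i => ?_
  rw [Derivation.leibniz_pow]
  cases k with
  | zero => simp
  | succ k =>
    simp only [smul_eq_mul, nsmul_eq_mul, Nat.add_sub_cancel]
    push_cast
    ring

/-- If the non-units are the functions vanishing at the base point, a function `x` vanishing there is
nilpotent modulo the Jacobian ideal: it is algebraic modulo this ideal, and the part of the equation
prime to `x` is invertible. -/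
theorem exists_pow_mem_jacobianIdeal (hfin : FiniteCodim D f) (ε : F →ₐ[K] K)
    (hε : ∀ u, ε u ≠ 0 → IsUnit u) {x : F} (hx : ε x = 0) :
    ∃ N : ℕ, x ^ N ∈ jacobianIdeal D f := by
  have : Module.Finite K (F ⧸ jacobianIdeal D f) := hfin
  obtain ⟨P, hP, hP0⟩ := Algebra.IsIntegral.isIntegral (R := K)
    (Ideal.Quotient.mk (jacobianIdeal D f) x)
  obtain ⟨Q, hQ, hQ0⟩ := Polynomial.exists_eq_pow_rootMultiplicity_mul_and_not_dvd P hP.ne_zero 0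
  refine ⟨P.rootMultiplicity 0, ?_⟩
  rw [Polynomial.dvd_iff_isRoot, Polynomial.IsRoot] at hQ0
  have hu : IsUnit (Polynomial.aeval x Q) := hε _ (by
    rwa [← Polynomial.aeval_algHom_apply, hx, ← Polynomial.coe_aeval_eq_eval] at *)
  have hmem : Polynomial.aeval x P ∈ jacobianIdeal D f := by
    rw [← Ideal.Quotient.eq_zero_iff_mem, ← Ideal.Quotient.mkₐ_eq_mk K,
      ← Polynomial.aeval_algHom_apply]
    exact hP0
  rw [hQ] at hmem
  simp only [map_zero, sub_zero, map_mul, map_pow, Polynomial.aeval_X] at hmem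
  exact (Ideal.mul_unit_mem_iff_mem _ hu).1 hmem

theorem mul_mem_of_mem_jacobianIdeal {I : Ideal F} {g : F} (hg : ∀ i, g * D i f ∈ I) {P : F}
    (hP : P ∈ jacobianIdeal D f) : g * P ∈ I := by
  have : jacobianIdeal D f ≤ Submodule.comap (LinearMap.mulLeft F g) I := by
    refine Ideal.span_le.2 ?_
    rintro _ ⟨i, rfl⟩
    exact hg i
  exact this hP

/-- If `f u = 0`, then `u²` is annihilated by the partial derivatives of `f`, hence by a power
of `x`. -/
theorem eq_zero_of_mul_eq_zero_of_pow_mem [IsReduced F] {x : F} (hx : ∀ a, x * a = 0 → a = 0)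
    {N : ℕ} (hN : x ^ N ∈ jacobianIdeal D f) (u : F) (hu : f * u = 0) : u = 0 := by
  have h1 : ∀ i, u ^ 2 * D i f ∈ (⊥ : Ideal F) := fun i => by
    have h := congrArg (D i) hu
    rw [Derivation.leibniz, map_zero] at h
    simp only [smul_eq_mul] at h
    rw [Ideal.mem_bot]
    linear_combination u * h - D i u * hu
  have h2 := Ideal.mem_bot.1 (mul_mem_of_mem_jacobianIdeal h1 hN)
  have key : ∀ N : ℕ, u ^ 2 * x ^ N = 0 → u ^ 2 = 0 := by
    intro k
    induction k with
    | zero => simp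
    | succ k ih => exact fun h => ih (hx _ (by rw [← h]; ring))
  exact pow_eq_zero_iff two_ne_zero |>.1 (key N h2)

theorem pow_dvd_of_pow_dvd_pow_mul {x y : F} (hx : ∀ a, x * a = 0 → a = 0)
    (hxy : ∀ a, x ∣ y * a → x ∣ a) (N M : ℕ) (a : F) (h : x ^ N ∣ y ^ M * a) : x ^ N ∣ a := by
  have h1 : ∀ (N : ℕ) (a : F), x ^ N ∣ y * a → x ^ N ∣ a := by
    intro N
    induction N with
    | zero => simp
    | succ N ih =>
      rintro a ⟨c, hc⟩
      obtain ⟨a, rfl⟩ := hxy a ⟨x ^ N * c, by rw [hc]; ring⟩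
      obtain ⟨b, rfl⟩ := ih a ⟨c, sub_eq_zero.1 (hx _ (by linear_combination hc))⟩
      exact ⟨b, by ring⟩
  induction M with
  | zero => simpa using h
  | succ M ih => exact ih (h1 N _ (by rwa [← mul_assoc, ← pow_succ']))

/-- The key divisibility: since the Jacobian ideal contains powers of the regular sequence `x, y`,
a function `g` such that `f` divides all `g ∂f/∂xᵢ` is divisible by `f`. -/
theorem dvd_of_forall_dvd_mul_partial {x y : F} (hx : ∀ a, x * a = 0 → a = 0)
    (hxy : ∀ a, x ∣ y * a → x ∣ a) (hf : ∀ u, f * u = 0 → u = 0)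
    {N M : ℕ} (hN : x ^ N ∈ jacobianIdeal D f) (hM : y ^ M ∈ jacobianIdeal D f)
    (g : F) (hg : ∀ i, f ∣ g * D i f) : f ∣ g := by
  have hg' : ∀ i, g * D i f ∈ Ideal.span {f} := fun i => Ideal.mem_span_singleton.2 (hg i)
  obtain ⟨a, ha⟩ := Ideal.mem_span_singleton.1 (mul_mem_of_mem_jacobianIdeal hg' hN)
  obtain ⟨b, hb⟩ := Ideal.mem_span_singleton.1 (mul_mem_of_mem_jacobianIdeal hg' hM)
  have hab : y ^ M * a = x ^ N * b :=
    sub_eq_zero.1 (hf _ (by linear_combination x ^ N * hb - y ^ M * ha))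
  obtain ⟨c, rfl⟩ := pow_dvd_of_pow_dvd_pow_mul hx hxy N M a ⟨b, hab⟩
  have key : ∀ (N : ℕ) (u : F), x ^ N * u = 0 → u = 0 := by
    intro k
    induction k with
    | zero => simp
    | succ k ih => exact fun u h => hx _ (ih _ (by rw [← h]; ring))
  exact ⟨c, sub_eq_zero.1 (key N _ (by linear_combination ha))⟩

variable {F' : Type*} [CommRing F'] [Algebra K F'] {D' : Fin n → Derivation K F' F'}
  {ι : F →ₐ[K] F'}

theorem map_mem_jacobianIdeal (hι : ∀ i g, D' i (ι g) = ι (D i g)) {g : F}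
    (hg : g ∈ jacobianIdeal D f) : ι g ∈ jacobianIdeal D' (ι f) := by
  have : jacobianIdeal D f ≤ (jacobianIdeal D' (ι f)).comap ι := by
    refine Ideal.span_le.2 ?_
    rintro _ ⟨i, rfl⟩
    exact Ideal.subset_span ⟨i, hι i f⟩
  exact this hg

theorem map_mem_H0 (hι : ∀ i g, D' i (ι g) = ι (D i g)) {g : F} {p : ℤ} (hg : g ∈ H0 D f p) :
    ι g ∈ H0 D' (ι f) p := by
  rw [mem_H0_iff] at hg ⊢
  intro i
  have := congrArg ι (hg i)
  simpa only [map_add, map_mul, map_intCast, map_zero, hι] using this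

end Abstract

/-! ### The Nambu-Poisson cocycles of degree zero -/

section NambuPoissonCocycles

variable {K F : Type*} [Field K] [CommRing F] [Algebra K F]

/-- The `m`-form `i_θ (dx₁ ∧ ⋯ ∧ dxₘ₊₁)`, with `θ` inserted in the last place. -/
def lastContraction {m : ℕ} (θ : Fin (m + 1) → F) : (Fin (m + 1) → F) [⋀^Fin m]→ₗ[F] F where
  toFun v := Matrix.detRowAlternating (Fin.snoc (α := fun _ => Fin (m + 1) → F) v θ)
  map_update_add' := @fun inst v i a b => by
    obtain rfl : inst = instDecidableEqFin m := Subsingleton.elim _ _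
    simp only [Fin.snoc_update, AlternatingMap.map_update_add]
  map_update_smul' := @fun inst v i c a => by
    obtain rfl : inst = instDecidableEqFin m := Subsingleton.elim _ _
    simp only [Fin.snoc_update, AlternatingMap.map_update_smul]
  map_eq_zero_of_eq' v i j h hij :=
    AlternatingMap.map_eq_zero_of_eq _ _ (i := i.castSucc) (j := j.castSucc) (by simpa using h)
      (by simpa using hij)

theorem detRowAlternating_single_of_not_injective {m : ℕ} {σ : Fin m → Fin m}
    (hσ : ¬ Function.Injective σ) :
    Matrix.detRowAlternating (fun i => (Pi.single (σ i) 1 : Fin m → F)) = 0 :=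
  AlternatingMap.map_eq_zero_of_not_injective _ _ fun h =>
    hσ fun a b hab => h (by simp only [hab])

theorem detRowAlternating_single_mul_self {m : ℕ} {σ : Fin m → Fin m}
    (hσ : Function.Injective σ) :
    Matrix.detRowAlternating (fun i => (Pi.single (σ i) 1 : Fin m → F)) *
      Matrix.detRowAlternating (fun i => (Pi.single (σ i) 1 : Fin m → F)) = 1 := by
  let τ : Equiv.Perm (Fin m) := Equiv.ofBijective σ (Finite.injective_iff_bijective.1 hσ)
  have h : Matrix.detRowAlternating (fun i => (Pi.single (σ i) 1 : Fin m → F)) =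
      ((Equiv.Perm.sign τ : ℤ) : F) := by
    have := AlternatingMap.map_perm (Matrix.detRowAlternating (R := F))
      (fun i => (Pi.single i 1 : Fin m → F)) τ
    have h1 : Matrix.detRowAlternating (fun i => (Pi.single i 1 : Fin m → F)) = 1 := by
      rw [← Matrix.det_one (n := Fin m) (R := F)]
      exact congrArg _ (Matrix.ext fun i j => by simp [Matrix.one_apply, Pi.single_apply, eq_comm])
    rw [h1] at this
    simpa [Function.comp_def, τ, Units.smul_def] using this
  rw [h, ← Int.cast_mul, ← Units.val_mul, Int.units_mul_self]
  simp

/-- The anchor maps `i_{∂ⱼ} (dx₁ ∧ ⋯ ∧ dxₙ)` to a nonzero multiple of `f ∂/∂xⱼ`. The term of the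
family `s` in the `j'`-th coefficient is `f` times the product of the determinants of
`(e_{s 0}, …, e_{s (m-1)}, eⱼ)` and `(e_{s 0}, …, e_{s (m-1)}, eⱼ')`: it is `f` if `j' = j` and `s`
misses `j`, and `0` otherwise. Hence `N` is the number of increasing `s` missing `j`; that this
number is not zero is all that is needed. -/
theorem exists_sharp_lastContraction_eq {m : ℕ} (f : F) (j : Fin (m + 1)) :
    ∃ N : ℕ, N ≠ 0 ∧
      sharp (n := m + 1) f (lastContraction (Pi.single j 1)) = Pi.single j (N * f) := by
  classical
  have hsnoc : ∀ (s : Fin m → Fin (m + 1)) (j : Fin (m + 1)),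
      (Fin.snoc (α := fun _ => Fin (m + 1) → F) (fun a => Pi.single (s a) 1) (Pi.single j 1)) =
      fun i => (Pi.single (Fin.snoc (α := fun _ => Fin (m + 1)) s j i) 1) := by
    intro s j
    funext i
    refine Fin.lastCases ?_ (fun i => ?_) i <;> simp
  have hdite : ∀ (s : Fin m → Fin (m + 1)) (j : Fin (m + 1)),
      (fun i : Fin (m + 1) => if h : (i : ℕ) < m + 1 - 1 then
        (Pi.single (s ⟨i, h⟩) 1 : Fin (m + 1) → F) else Pi.single j 1) =
      fun i => (Pi.single (Fin.snoc (α := fun _ => Fin (m + 1)) s j i) 1) := by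
    intro s j
    funext i
    refine Fin.lastCases ?_ (fun i => ?_) i <;> simp
  have hinj : ∀ (s : Fin m → Fin (m + 1)) (j : Fin (m + 1)),
      Function.Injective (Fin.snoc (α := fun _ => Fin (m + 1)) s j) ↔
        Function.Injective s ∧ j ∉ Set.range s := fun s j => Fin.snoc_injective_iff
  refine ⟨(Finset.univ.filter fun s : Fin m → Fin (m + 1) => StrictMono s ∧
    Function.Injective (Fin.snoc (α := fun _ => Fin (m + 1)) s j)).card, ?_, ?_⟩
  · refine Finset.card_ne_zero.2 ⟨j.succAbove, ?_⟩
    simp only [Finset.mem_filter, Finset.mem_univ, true_and]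
    exact ⟨Fin.strictMono_succAbove j, (hinj _ _).2 ⟨Fin.succAbove_right_injective, by simp⟩⟩
  · funext j'
    unfold sharp
    simp only [topVector, AlternatingMap.smul_apply, smul_eq_mul]
    have hterm : ∀ s : Fin m → Fin (m + 1),
        (lastContraction (Pi.single j 1 : Fin (m + 1) → F)) (fun a => Pi.single (s a) 1) *
          (f * Matrix.detRowAlternating (fun i : Fin (m + 1) => if h : (i : ℕ) < m + 1 - 1 then
            (Pi.single (s ⟨i, h⟩) 1 : Fin (m + 1) → F) else Pi.single j' 1)) =
        if Function.Injective (Fin.snoc (α := fun _ => Fin (m + 1)) s j) then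
          (Pi.single j f : Fin (m + 1) → F) j' else 0 := by
      intro s
      rw [hdite]
      change Matrix.detRowAlternating (Fin.snoc (α := fun _ => Fin (m + 1) → F) _ _) * _ = _
      rw [hsnoc]
      split_ifs with hs
      · by_cases hj : j' = j
        · subst hj
          rw [Pi.single_eq_same, mul_left_comm, detRowAlternating_single_mul_self hs, mul_one]
        · rw [Pi.single_eq_of_ne hj, detRowAlternating_single_of_not_injective (σ := Fin.snoc
            (α := fun _ => Fin (m + 1)) s j'), mul_zero, mul_zero]
          -- An injective family `s` missing `j` takes the value `j'`.
          intro hs'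
          rw [hinj] at hs hs'
          have hr : Finset.univ.image s ⊆ {j, j'}ᶜ := by
            intro a ha
            simp only [Finset.mem_image, Finset.mem_univ, true_and] at ha
            obtain ⟨b, rfl⟩ := ha
            simp only [Finset.mem_compl, Finset.mem_insert, Finset.mem_singleton, not_or]
            exact ⟨fun h => hs.2 ⟨b, h⟩, fun h => hs'.2 ⟨b, h⟩⟩
          have hc := Finset.card_le_card hr
          rw [Finset.card_image_of_injective _ hs.1, Finset.card_compl,
            Finset.card_pair (Ne.symm hj)] at hc
          simp only [Finset.card_univ, Fintype.card_fin] at hc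
          have := j.2
          have := j'.2
          have : (j : ℕ) ≠ j' := fun h => hj (Fin.ext h.symm)
          omega
      · rw [detRowAlternating_single_of_not_injective hs, zero_mul]
    refine (Finset.sum_congr rfl fun s _ => hterm s).trans ?_
    rw [← Finset.sum_filter, Finset.sum_const, Finset.filter_filter, nsmul_eq_mul]
    by_cases hj : j' = j
    · subst hj
      simp
    · simp [Pi.single_eq_of_ne hj]

theorem one_mem_H0NP {n : ℕ} {D : Fin n → Derivation K F F} {f : F} : 1 ∈ H0NP D f := by
  rw [H0NP, LinearMap.mem_ker]
  funext α
  simp [npDiff, fieldAct]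

/-- The vector fields `#_Λ α` span the multiples of `f`, so a Nambu-Poisson cocycle of degree zero
has vanishing partial derivatives. -/
theorem partial_eq_zero_of_mem_H0NP [CharZero K] {n : ℕ} {D : Fin n → Derivation K F F} {f : F}
    (hf : ∀ u, f * u = 0 → u = 0) {g : F} (hg : g ∈ H0NP D f) (j : Fin n) : D j g = 0 := by
  obtain _ | m := n
  · exact j.elim0
  obtain ⟨N, hN, hs⟩ := exists_sharp_lastContraction_eq f j
  rw [H0NP, LinearMap.mem_ker] at hg
  have h := congrFun hg (lastContraction (Pi.single j 1))
  simp only [npDiff, LinearMap.pi_apply, fieldAct, LinearMap.sum_apply, hs] at h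
  rw [Finset.sum_eq_single j] at h
  · simp only [Derivation.coeFn_coe, Derivation.smul_apply, Pi.single_eq_same, smul_eq_mul,
      Pi.zero_apply] at h
    have hu : IsUnit (N : F) := by
      rw [← map_natCast (algebraMap K F)]
      exact (IsUnit.mk0 _ (Nat.cast_ne_zero.2 hN)).map _
    rw [mul_assoc, hu.mul_right_eq_zero] at h
    exact hf _ h
  · intro b _ hb
    simp [Pi.single_eq_of_ne hb]
  · simp

end NambuPoissonCocycles

/-! ### Formal power series -/

section Formal

variable {σ K : Type*} [Field K]

/-- The constant coefficient of a formal power series, as a morphism of algebras. -/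
def constantCoeffAlgHom : MvPowerSeries σ K →ₐ[K] K :=
  { MvPowerSeries.constantCoeff with
    commutes' := fun c => by simp [MvPowerSeries.algebraMap_apply] }

theorem powerSeries_X_dvd_of_X_dvd_X_mul {i j : σ} (hij : i ≠ j) (a : MvPowerSeries σ K)
    (h : (MvPowerSeries.X i : MvPowerSeries σ K) ∣ MvPowerSeries.X j * a) :
    (MvPowerSeries.X i : MvPowerSeries σ K) ∣ a := by
  rw [MvPowerSeries.X_dvd_iff] at h ⊢
  intro m hm
  have := h (Finsupp.single j 1 + m) (by simp [hm, hij.symm])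
  rwa [MvPowerSeries.X, MvPowerSeries.coeff_add_monomial_mul, one_mul] at this

theorem powerSeries_eq_const_of_pderiv_eq_zero [CharZero K] (g : MvPowerSeries σ K)
    (hg : ∀ i, MvPowerSeries.pderiv K i g = 0) : ∃ c : K, g = algebraMap K _ c := by
  refine ⟨MvPowerSeries.constantCoeff g, MvPowerSeries.pderiv.ext (fun i => ?_) ?_⟩
  · rw [hg, Derivation.map_algebraMap]
  · simp [MvPowerSeries.algebraMap_apply]

end Formal

/-! ### Integrals of smooth functions depending on a parameter -/

section ParametricIntegral

-- All spaces live in one universe: the induction on the order of differentiability replaces the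
-- values in `F` by values in `E →L[𝕜] F`.
universe u

variable {𝕜 E : Type u} [RCLike 𝕜] [NormedAddCommGroup E] [NormedSpace 𝕜 E]
  {L : ℝ → E →L[𝕜] E} {ε : ℝ}

theorem continuousOn_clm_apply_comp {F F' : Type*} [NormedAddCommGroup F] [NormedSpace 𝕜 F]
    [NormedAddCommGroup F'] [NormedSpace 𝕜 F']
    (hL : Continuous L) (hL1 : ∀ t ∈ Set.Icc (0 : ℝ) 1, ∀ x, ‖L t x‖ ≤ ‖x‖)
    {G : E → F} (hG : ContinuousOn G (Metric.ball 0 ε)) {w : ℝ → F →L[𝕜] F'} (hw : Continuous w)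
    {x : E} (hx : x ∈ Metric.ball 0 ε) :
    ContinuousOn (fun t => w t (G (L t x))) (Set.uIcc 0 1) := by
  rw [Set.uIcc_of_le zero_le_one]
  refine hw.continuousOn.clm_apply (hG.comp (by fun_prop) fun t ht => ?_)
  rw [mem_ball_zero_iff] at hx ⊢
  exact (hL1 t ht x).trans_lt hx

variable [ProperSpace E]

theorem exists_bound_clm_apply_comp {F F' : Type*} [NormedAddCommGroup F] [NormedSpace 𝕜 F]
    [NormedAddCommGroup F'] [NormedSpace 𝕜 F']
    (hL1 : ∀ t ∈ Set.Icc (0 : ℝ) 1, ∀ x, ‖L t x‖ ≤ ‖x‖)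
    {G : E → F} (hG : ContinuousOn G (Metric.ball 0 ε)) {w : ℝ → F →L[𝕜] F'} (hw : Continuous w)
    {x : E} (hx : x ∈ Metric.ball 0 ε) :
    ∃ s ∈ 𝓝 x, s ⊆ Metric.ball 0 ε ∧
      ∃ C, ∀ t ∈ Set.Icc (0 : ℝ) 1, ∀ y ∈ s, ‖w t (G (L t y))‖ ≤ C := by
  rw [mem_ball_zero_iff] at hx
  obtain ⟨ρ, hxρ, hρ⟩ := exists_between hx
  obtain ⟨A, hA⟩ := (isCompact_closedBall (0 : E) ρ).exists_bound_of_continuousOn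
    (hG.mono (Metric.closedBall_subset_ball hρ))
  obtain ⟨B, hB⟩ := (isCompact_Icc (a := (0 : ℝ)) (b := 1)).exists_bound_of_continuousOn
    hw.continuousOn
  refine ⟨Metric.closedBall 0 ρ, Metric.closedBall_mem_nhds_of_mem (by simpa using hxρ),
    Metric.closedBall_subset_ball hρ, B * A, fun t ht y hy => ?_⟩
  have hLy : L t y ∈ Metric.closedBall (0 : E) ρ := by
    rw [mem_closedBall_zero_iff] at hy ⊢
    exact (hL1 t ht y).trans hy
  exact (w t).le_of_opNorm_le_of_le (hB t ht) (hA _ hLy)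

/-- Integrals `∫₀¹ w(t) G(L_t x) dt` are as smooth as `G`. Differentiation under the integral
sign gives an integral of the same shape, with the weight `w` replaced by `A ↦ w t ∘ A ∘ L t`; this
is what makes the induction on `n` work. -/
theorem contDiffOn_integral_clm_apply_comp (hL : Continuous L)
    (hL1 : ∀ t ∈ Set.Icc (0 : ℝ) 1, ∀ x, ‖L t x‖ ≤ ‖x‖) (n : ℕ) :
    ∀ {F F' : Type u} [NormedAddCommGroup F] [NormedSpace 𝕜 F]
      [NormedAddCommGroup F'] [NormedSpace 𝕜 F'] [NormedSpace ℝ F'] {G : E → F}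
      (_ : ContDiffOn 𝕜 n G (Metric.ball 0 ε)) {w : ℝ → F →L[𝕜] F'} (_ : Continuous w),
      ContDiffOn 𝕜 n (fun x => ∫ t in (0 : ℝ)..1, w t (G (L t x))) (Metric.ball 0 ε) := by
  have hsub : Set.uIoc (0 : ℝ) 1 ⊆ Set.Icc 0 1 := by
    rw [Set.uIoc_of_le zero_le_one]
    exact Set.Ioc_subset_Icc_self
  have hsub' : Set.uIoc (0 : ℝ) 1 ⊆ Set.uIcc 0 1 := Set.uIoc_subset_uIcc
  have hball : ∀ t ∈ Set.Icc (0 : ℝ) 1, ∀ y ∈ Metric.ball (0 : E) ε,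
      L t y ∈ Metric.ball (0 : E) ε := fun t ht y hy => by
    rw [mem_ball_zero_iff] at hy ⊢
    exact (hL1 t ht y).trans_lt hy
  induction n with
  | zero =>
    intro F F' _ _ _ _ _ G hG w hw
    simp only [Nat.cast_zero, contDiffOn_zero] at hG ⊢
    intro x hx
    refine ContinuousAt.continuousWithinAt ?_
    obtain ⟨s, hs, hsb, C, hC⟩ := exists_bound_clm_apply_comp hL1 hG hw hx
    refine intervalIntegral.continuousAt_of_dominated_interval (bound := fun _ => C) ?_ ?_
      intervalIntegrable_const ?_
    · filter_upwards [hs] with y hy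
      exact ((continuousOn_clm_apply_comp hL hL1 hG hw (hsb hy)).mono
        hsub').aestronglyMeasurable measurableSet_uIoc
    · filter_upwards [hs] with y hy
      exact MeasureTheory.ae_of_all _ fun t ht => hC t (hsub ht) y hy
    · refine MeasureTheory.ae_of_all _ fun t ht => ?_
      exact (w t).continuous.continuousAt.comp ((hG.continuousAt (Metric.isOpen_ball.mem_nhds
        (hball t (hsub ht) x hx))).comp (L t).continuous.continuousAt)
  | succ n ih =>
    intro F F' _ _ _ _ _ G hG w hw
    push_cast at hG ⊢
    have hGc : ContinuousOn G (Metric.ball 0 ε) := hG.continuousOn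
    rw [contDiffOn_succ_iff_fderiv_of_isOpen Metric.isOpen_ball] at hG
    obtain ⟨hGd, -, hG'⟩ := hG
    set w' : ℝ → (E →L[𝕜] F) →L[𝕜] (E →L[𝕜] F') := fun t =>
      (ContinuousLinearMap.compL 𝕜 E F F' (w t)) ∘L
        ((ContinuousLinearMap.compL 𝕜 E E F).flip (L t)) with hw'
    have hw'c : Continuous w' := by
      rw [hw']
      fun_prop
    have hd : ∀ x ∈ Metric.ball (0 : E) ε, HasFDerivAt
        (fun x => ∫ t in (0 : ℝ)..1, w t (G (L t x)))
        (∫ t in (0 : ℝ)..1, w' t (fderiv 𝕜 G (L t x))) x := by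
      intro x hx
      obtain ⟨s, hs, hsb, C, hC⟩ := exists_bound_clm_apply_comp hL1 hG'.continuousOn hw'c hx
      refine intervalIntegral.hasFDerivAt_integral_of_dominated_of_fderiv_le
        (F := fun x t => w t (G (L t x))) (F' := fun x t => w' t (fderiv 𝕜 G (L t x)))
        (bound := fun _ => C) hs ?_ ?_ ?_ ?_ intervalIntegrable_const ?_
      · filter_upwards [hs] with y hy
        exact ((continuousOn_clm_apply_comp hL hL1 hGc hw (hsb hy)).mono
          hsub').aestronglyMeasurable measurableSet_uIoc
      · exact (continuousOn_clm_apply_comp hL hL1 hGc hw hx).intervalIntegrable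
      · exact ((continuousOn_clm_apply_comp hL hL1 hG'.continuousOn hw'c hx).mono
          hsub').aestronglyMeasurable measurableSet_uIoc
      · exact MeasureTheory.ae_of_all _ fun t ht y hy => hC t (hsub ht) y hy
      · refine MeasureTheory.ae_of_all _ fun t ht y hy => ?_
        have h1 : HasFDerivAt G (fderiv 𝕜 G (L t y)) (L t y) :=
          (hGd.differentiableAt (Metric.isOpen_ball.mem_nhds
            (hball t (hsub ht) y (hsb hy)))).hasFDerivAt
        exact (w t).hasFDerivAt.comp y (h1.comp y (L t).hasFDerivAt)
    rw [contDiffOn_succ_iff_fderiv_of_isOpen Metric.isOpen_ball]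
    refine ⟨fun x hx => (hd x hx).differentiableAt.differentiableWithinAt,
      fun h => absurd h (by simp), ?_⟩
    exact (ih hG' hw'c).congr fun x hx => (hd x hx).fderiv

end ParametricIntegral

/-! ### Germs of smooth and analytic functions -/

section GermLemmas

universe u

variable {𝕜 : Type u} [RCLike 𝕜] {n : ℕ} {r : WithTop ℕ∞}

/-- The germ of a function of class `C^r` near `0`. -/
def FunGerm.mk (u : (Fin n → 𝕜) → 𝕜) (hu : ∀ᶠ x in 𝓝 0, ContDiffAt 𝕜 r u x) : FunGerm 𝕜 n r :=
  ⟨(u : Germ _ 𝕜), u, hu, rfl⟩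

theorem FunGerm.exists_mk (φ : FunGerm 𝕜 n r) :
    ∃ (u : (Fin n → 𝕜) → 𝕜) (hu : ∀ᶠ x in 𝓝 0, ContDiffAt 𝕜 r u x), φ = FunGerm.mk u hu := by
  obtain ⟨_, u, hu, rfl⟩ := φ
  exact ⟨u, hu, rfl⟩

theorem FunGerm.mk_eq_mk {u v : (Fin n → 𝕜) → 𝕜} {hu : ∀ᶠ x in 𝓝 0, ContDiffAt 𝕜 r u x}
    {hv : ∀ᶠ x in 𝓝 0, ContDiffAt 𝕜 r v x} :
    FunGerm.mk u hu = FunGerm.mk v hv ↔ ∀ᶠ x in 𝓝 0, u x = v x := by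
  rw [Subtype.ext_iff]
  exact Germ.coe_eq

theorem FunGerm.mk_eq_zero {u : (Fin n → 𝕜) → 𝕜} {hu : ∀ᶠ x in 𝓝 0, ContDiffAt 𝕜 r u x} :
    FunGerm.mk u hu = 0 ↔ ∀ᶠ x in 𝓝 0, u x = 0 := by
  rw [Subtype.ext_iff]
  exact Germ.coe_eq

theorem FunGerm.mk_mul_mk {u v : (Fin n → 𝕜) → 𝕜} {hu : ∀ᶠ x in 𝓝 0, ContDiffAt 𝕜 r u x}
    {hv : ∀ᶠ x in 𝓝 0, ContDiffAt 𝕜 r v x} :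
    FunGerm.mk u hu * FunGerm.mk v hv =
      FunGerm.mk (u * v) ((hu.and hv).mono fun _ h => h.1.mul h.2) := rfl

theorem FunGerm.algebraMap_eq_mk (c : 𝕜) :
    algebraMap 𝕜 (FunGerm 𝕜 n r) c =
      FunGerm.mk (fun _ => c) (Eventually.of_forall fun _ => contDiffAt_const) := by
  rw [Algebra.algebraMap_eq_smul_one]
  refine Subtype.ext (Germ.coe_eq.2 (Eventually.of_forall fun x => ?_))
  change c • (1 : 𝕜) = c
  simp

/-- The coordinate function `xᵢ`. -/
def coordGerm (i : Fin n) : FunGerm 𝕜 n r :=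
  FunGerm.mk (fun x => x i) (Eventually.of_forall fun _ => (contDiff_apply 𝕜 𝕜 i).contDiffAt)

/-- The value of a germ at `0`, as a morphism of algebras. -/
def valueAlgHom : FunGerm 𝕜 n r →ₐ[𝕜] 𝕜 :=
  { (Germ.valueRingHom.comp (FunGerm 𝕜 n r).val.toRingHom : FunGerm 𝕜 n r →+* 𝕜) with
    commutes' := fun c => by
      rw [FunGerm.algebraMap_eq_mk]
      rfl }

theorem valueAlgHom_coordGerm (i : Fin n) :
    valueAlgHom (coordGerm i : FunGerm 𝕜 n r) = 0 := rfl

theorem isUnit_of_valueAlgHom_ne_zero (φ : FunGerm 𝕜 n r)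
    (hφ : valueAlgHom φ ≠ 0) : IsUnit φ := by
  obtain ⟨u, hu, rfl⟩ := FunGerm.exists_mk φ
  have hc : ContinuousAt u 0 := hu.self_of_nhds.continuousAt
  have h0 : ∀ᶠ x in 𝓝 0, u x ≠ 0 := hc.eventually_ne hφ
  refine IsUnit.of_mul_eq_one 
    (FunGerm.mk (fun x => (u x)⁻¹) ((hu.and h0).mono fun _ h => h.1.inv h.2)) ?_
  rw [FunGerm.mk_mul_mk, ← map_one (algebraMap 𝕜 (FunGerm 𝕜 n r)), FunGerm.algebraMap_eq_mk,
    FunGerm.mk_eq_mk]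
  filter_upwards [h0] with x hx using mul_inv_cancel₀ hx

instance isReduced_funGerm : IsReduced (FunGerm 𝕜 n r) where
  eq_zero := by
    rintro φ ⟨k, hk⟩
    obtain ⟨u, hu, rfl⟩ := FunGerm.exists_mk φ
    have h : ∀ᶠ x in 𝓝 0, u x ^ k = 0 := Germ.coe_eq.1 (congrArg Subtype.val hk)
    rw [FunGerm.mk_eq_zero]
    filter_upwards [h] with x hx using eq_zero_of_pow_eq_zero hx

theorem funGerm_eq_const_of_partial_eq_zero (hr : ∞ ≤ r) (φ : FunGerm 𝕜 n r)
    (hφ : ∀ i, germDer hr i φ = 0) : ∃ c : 𝕜, φ = algebraMap 𝕜 _ c := by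
  obtain ⟨u, hu, rfl⟩ := FunGerm.exists_mk φ
  have h1 : ∀ᶠ x in 𝓝 (0 : Fin n → 𝕜), ∀ i, fderiv 𝕜 u x (Pi.single i 1) = 0 :=
    eventually_all.2 fun i => Germ.coe_eq.1 (congrArg Subtype.val (hφ i))
  obtain ⟨ε, hε, hball⟩ := Metric.eventually_nhds_iff_ball.1 (hu.and h1)
  refine ⟨u 0, ?_⟩
  rw [FunGerm.algebraMap_eq_mk, FunGerm.mk_eq_mk]
  filter_upwards [Metric.ball_mem_nhds (0 : Fin n → 𝕜) hε] with x hx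
  refine Metric.isOpen_ball.is_const_of_fderiv_eq_zero (𝕜 := 𝕜)
    (convex_ball (0 : Fin n → 𝕜) ε).isPreconnected (fun y hy =>
      ((hball y hy).1.differentiableAt (ne_zero_of_infty_le hr)).differentiableWithinAt)
    (fun y hy => ?_) hx (Metric.mem_ball_self hε)
  refine ContinuousLinearMap.coe_injective (LinearMap.pi_ext' fun i => LinearMap.ext_ring ?_)
  exact (hball y hy).2 i

/-- If `xᵢ u = 0` on a set invariant under the translations `x ↦ x + t eᵢ`, then `u = 0` there, by continuity. -/
theorem eventually_eq_zero_of_mul_coord {u : (Fin n → 𝕜) → 𝕜} (hu : ∀ᶠ x in 𝓝 0, ContinuousAt u x)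
    (i : Fin n) {P : (Fin n → 𝕜) → Prop} (hP : ∀ x (t : 𝕜), P x → P (x + t • Pi.single i 1))
    (h : ∀ᶠ x in 𝓝 0, P x → x i * u x = 0) : ∀ᶠ x in 𝓝 0, P x → u x = 0 := by
  filter_upwards [hu, eventually_eventually_nhds.2 h] with x hx h PX
  by_cases hxi : x i = 0
  · have hc : ContinuousAt (fun t : 𝕜 => x + t • (Pi.single i 1 : Fin n → 𝕜)) 0 := by fun_prop
    have hc0 : x + (0 : 𝕜) • (Pi.single i 1 : Fin n → 𝕜) = x := by simp
    have h1 : Tendsto (fun t : 𝕜 => x + t • (Pi.single i 1 : Fin n → 𝕜)) (𝓝[≠] 0) (𝓝 x) := by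
      have := hc.tendsto
      rw [hc0] at this
      exact this.mono_left nhdsWithin_le_nhds
    refine tendsto_nhds_unique (hx.tendsto.comp h1) (tendsto_const_nhds.congr' ?_)
    filter_upwards [h1.eventually h, self_mem_nhdsWithin] with t ht ht0
    have := ht (hP x t PX)
    simp only [Pi.add_apply, hxi, Pi.smul_apply, Pi.single_eq_same, smul_eq_mul, mul_one, zero_add,
      mul_eq_zero] at this
    exact (this.resolve_left ht0).symm
  · exact (mul_eq_zero.1 (h.self_of_nhds PX)).resolve_left hxi

theorem eq_zero_of_coordGerm_mul_eq_zero (i : Fin n) (φ : FunGerm 𝕜 n r)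
    (h : coordGerm i * φ = 0) : φ = 0 := by
  obtain ⟨u, hu, rfl⟩ := FunGerm.exists_mk φ
  rw [coordGerm, FunGerm.mk_mul_mk, FunGerm.mk_eq_zero] at h
  rw [FunGerm.mk_eq_zero]
  have := eventually_eq_zero_of_mul_coord (P := fun _ => True)
    (hu.mono fun x hx => hx.continuousAt) i (fun _ _ => id) (h.mono fun x hx _ => hx)
  exact this.mono fun x hx => hx trivial

/-- Multiplication of the `i`-th coordinate by the real number `t`. -/
def scaleCoord (i : Fin n) (t : ℝ) : (Fin n → 𝕜) →L[𝕜] (Fin n → 𝕜) :=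
  ContinuousLinearMap.id 𝕜 _ + ((t : 𝕜) - 1) •
    (ContinuousLinearMap.proj (R := 𝕜) (φ := fun _ : Fin n => 𝕜) i).smulRight
      (Pi.single i 1 : Fin n → 𝕜)

theorem scaleCoord_apply (i : Fin n) (t : ℝ) (x : Fin n → 𝕜) :
    scaleCoord i t x = x + ((t : 𝕜) - 1) • x i • Pi.single i 1 := rfl

theorem scaleCoord_apply_self (i : Fin n) (t : ℝ) (x : Fin n → 𝕜) :
    scaleCoord i t x i = t * x i := by
  simp [scaleCoord_apply]
  ring

theorem scaleCoord_apply_of_ne {i j : Fin n} (h : j ≠ i) (t : ℝ) (x : Fin n → 𝕜) :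
    scaleCoord i t x j = x j := by
  simp [scaleCoord_apply, Pi.single_eq_of_ne h]

theorem norm_scaleCoord_apply_le (i : Fin n) {t : ℝ} (ht : t ∈ Set.Icc (0 : ℝ) 1)
    (x : Fin n → 𝕜) : ‖scaleCoord i t x‖ ≤ ‖x‖ := by
  rw [pi_norm_le_iff_of_nonneg (norm_nonneg x)]
  intro j
  by_cases h : j = i
  · subst h
    rw [scaleCoord_apply_self, norm_mul, RCLike.norm_ofReal, abs_of_nonneg ht.1]
    exact (mul_le_of_le_one_left (norm_nonneg _) ht.2).trans (norm_le_pi_norm x j)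
  · rw [scaleCoord_apply_of_ne h]
    exact norm_le_pi_norm x j

theorem continuous_scaleCoord (i : Fin n) :
    Continuous (scaleCoord i : ℝ → (Fin n → 𝕜) →L[𝕜] (Fin n → 𝕜)) := by
  unfold scaleCoord
  have : Continuous fun t : ℝ => (t : 𝕜) := RCLike.continuous_ofReal
  fun_prop

theorem hasDerivAt_scaleCoord (i : Fin n) (x : Fin n → 𝕜) (t : ℝ) :
    HasDerivAt (fun t : ℝ => scaleCoord i t x) (x i • (Pi.single i 1 : Fin n → 𝕜)) t := by
  have h : HasDerivAt (fun t : ℝ => ((t : 𝕜) - 1)) 1 t := by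
    simpa using (RCLike.ofRealCLM (K := 𝕜)).hasDerivAt.sub_const 1 (x := t)
  simpa [scaleCoord_apply] using (h.smul_const (x i • (Pi.single i 1 : Fin n → 𝕜))).const_add x

/-- Evaluation of a linear form on `𝕜ⁿ` at the basis vector `eᵢ`. -/
def evalSingle (i : Fin n) : ((Fin n → 𝕜) →L[𝕜] 𝕜) →L[𝕜] 𝕜 :=
  ContinuousLinearMap.apply 𝕜 𝕜 (Pi.single i 1 : Fin n → 𝕜)

/-- The quotient of `u - u|_{xᵢ = 0}` by `xᵢ`, namely `∫₀¹ ∂ᵢu (x₁, …, t xᵢ, …, xₙ) dt`. -/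
def hadamardQuotient (i : Fin n) (u : (Fin n → 𝕜) → 𝕜) (x : Fin n → 𝕜) : 𝕜 :=
  ∫ t in (0 : ℝ)..1, evalSingle (𝕜 := 𝕜) i (fderiv 𝕜 u (scaleCoord i t x))

theorem contDiffOn_hadamardQuotient (i : Fin n) {u : (Fin n → 𝕜) → 𝕜} {ε : ℝ}
    (hu : ContDiffOn 𝕜 ∞ u (Metric.ball 0 ε)) :
    ContDiffOn 𝕜 ∞ (hadamardQuotient i u) (Metric.ball 0 ε) := by
  have hu' : ContDiffOn 𝕜 ∞ (fderiv 𝕜 u) (Metric.ball 0 ε) :=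
    ((contDiffOn_infty_iff_fderiv_of_isOpen Metric.isOpen_ball).1 hu).2
  have hw : Continuous fun _ : ℝ => (evalSingle (𝕜 := 𝕜) i : ((Fin n → 𝕜) →L[𝕜] 𝕜) →L[𝕜] 𝕜) :=
    continuous_const
  have hL1 : ∀ t ∈ Set.Icc (0 : ℝ) 1, ∀ x : Fin n → 𝕜, ‖scaleCoord i t x‖ ≤ ‖x‖ :=
    fun t ht => norm_scaleCoord_apply_le i ht
  exact contDiffOn_infty.2 fun m =>
    contDiffOn_integral_clm_apply_comp (E := Fin n → 𝕜) (L := scaleCoord i) (continuous_scaleCoord i) hL1 m (contDiffOn_infty.1 hu' m) hw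

theorem hasDerivAt_comp_scaleCoord (i : Fin n) {u : (Fin n → 𝕜) → 𝕜} (x : Fin n → 𝕜) (t : ℝ)
    (hu : DifferentiableAt 𝕜 u (scaleCoord i t x)) :
    HasDerivAt (fun t : ℝ => u (scaleCoord i t x))
      (x i * evalSingle (𝕜 := 𝕜) i (fderiv 𝕜 u (scaleCoord i t x))) t := by
  have h := (hu.hasFDerivAt.restrictScalars ℝ).comp_hasDerivAt t (hasDerivAt_scaleCoord i x t)
  rwa [ContinuousLinearMap.coe_restrictScalars', map_smul] at h

theorem coord_mul_hadamardQuotient (i : Fin n) {u : (Fin n → 𝕜) → 𝕜} {ε : ℝ}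
    (hu : ContDiffOn 𝕜 ∞ u (Metric.ball 0 ε)) {x : Fin n → 𝕜} (hx : x ∈ Metric.ball 0 ε) :
    x i * hadamardQuotient i u x = u x - u (scaleCoord i 0 x) := by
  have hderiv : ∀ t ∈ Set.uIcc (0 : ℝ) 1, HasDerivAt (fun t : ℝ => u (scaleCoord i t x))
      (x i * evalSingle (𝕜 := 𝕜) i (fderiv 𝕜 u (scaleCoord i t x))) t := by
    intro t ht
    rw [Set.uIcc_of_le zero_le_one] at ht
    have hmem : scaleCoord i t x ∈ Metric.ball (0 : Fin n → 𝕜) ε :=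
      mem_ball_zero_iff.2 ((norm_scaleCoord_apply_le i ht x).trans_lt (mem_ball_zero_iff.1 hx))
    exact hasDerivAt_comp_scaleCoord i x t
      ((hu.contDiffAt (Metric.isOpen_ball.mem_nhds hmem)).differentiableAt (by simp))
  have hu' : ContinuousOn (fderiv 𝕜 u) (Metric.ball 0 ε) :=
    ((contDiffOn_infty_iff_fderiv_of_isOpen Metric.isOpen_ball).1 hu).2.continuousOn
  have hw : Continuous fun _ : ℝ => (evalSingle (𝕜 := 𝕜) i : ((Fin n → 𝕜) →L[𝕜] 𝕜) →L[𝕜] 𝕜) :=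
    continuous_const
  have hL1 : ∀ t ∈ Set.Icc (0 : ℝ) 1, ∀ x : Fin n → 𝕜, ‖scaleCoord i t x‖ ≤ ‖x‖ :=
    fun t ht => norm_scaleCoord_apply_le i ht
  have hint : IntervalIntegrable (fun t => x i * evalSingle (𝕜 := 𝕜) i
      (fderiv 𝕜 u (scaleCoord i t x))) MeasureTheory.volume 0 1 :=
    ((continuousOn_clm_apply_comp (E := Fin n → 𝕜) (L := scaleCoord i) (continuous_scaleCoord i) hL1 hu' hw hx).intervalIntegrable).const_mul _
  have h := intervalIntegral.integral_eq_sub_of_hasDerivAt hderiv hint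
  have e1 : scaleCoord i 1 x = x := by simp [scaleCoord_apply]
  rwa [intervalIntegral.integral_const_mul, e1] at h

/-- **Hadamard's lemma**: a smooth germ vanishing for `xᵢ = 0` is a multiple of `xᵢ`. -/
theorem coordGerm_dvd_mk (i : Fin n) {u : (Fin n → 𝕜) → 𝕜}
    (hu : ∀ᶠ x in 𝓝 0, ContDiffAt 𝕜 ∞ u x) (h0 : ∀ᶠ x in 𝓝 0, x i = 0 → u x = 0) :
    coordGerm i ∣ (FunGerm.mk u hu : FunGerm 𝕜 n ∞) := by
  obtain ⟨ε, hε, hball⟩ := Metric.eventually_nhds_iff_ball.1 (hu.and h0)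
  have hcd : ContDiffOn 𝕜 ∞ u (Metric.ball 0 ε) := fun x hx => (hball x hx).1.contDiffWithinAt
  have hmem : ∀ᶠ x in 𝓝 (0 : Fin n → 𝕜), x ∈ Metric.ball 0 ε := Metric.ball_mem_nhds _ hε
  refine ⟨FunGerm.mk (hadamardQuotient i u) (hmem.mono fun x hx =>
    (contDiffOn_hadamardQuotient i hcd).contDiffAt (Metric.isOpen_ball.mem_nhds hx)), ?_⟩
  rw [coordGerm, FunGerm.mk_mul_mk, FunGerm.mk_eq_mk]
  filter_upwards [hmem] with x hx
  have hmem0 : scaleCoord i 0 x ∈ Metric.ball (0 : Fin n → 𝕜) ε :=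
    mem_ball_zero_iff.2 ((norm_scaleCoord_apply_le i (by simp) x).trans_lt
      (mem_ball_zero_iff.1 hx))
  have e0 : u (scaleCoord i 0 x) = 0 :=
    (hball _ hmem0).2 (by rw [scaleCoord_apply_self, RCLike.ofReal_zero, zero_mul])
  rw [Pi.mul_apply, coord_mul_hadamardQuotient i hcd hx, e0, sub_zero]

/-- If `xᵢ` divides `xⱼ φ`, then `φ` vanishes for `xᵢ = 0` and `xⱼ ≠ 0`, hence for `xᵢ = 0`. -/
theorem coordGerm_dvd_of_dvd_coordGerm_mul {i j : Fin n} (hij : i ≠ j) (φ : FunGerm 𝕜 n ∞)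
    (h : coordGerm i ∣ coordGerm j * φ) : coordGerm i ∣ φ := by
  obtain ⟨u, hu, rfl⟩ := FunGerm.exists_mk φ
  obtain ⟨ψ, h⟩ := h
  obtain ⟨v, hv, rfl⟩ := FunGerm.exists_mk ψ
  rw [coordGerm, coordGerm, FunGerm.mk_mul_mk, FunGerm.mk_mul_mk, FunGerm.mk_eq_mk] at h
  refine coordGerm_dvd_mk i hu (eventually_eq_zero_of_mul_coord
    (hu.mono fun x hx => hx.continuousAt) j (fun x t hx => ?_) ?_)
  · simp [hx, Pi.single_eq_of_ne hij]
  · filter_upwards [h] with x hx hxi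
    simpa [hxi] using hx

/-- Forgetting that a germ of class `C^r` is more than smooth. -/
def toSmooth (hr : ∞ ≤ r) : FunGerm 𝕜 n r →ₐ[𝕜] FunGerm 𝕜 n ∞ :=
  Subalgebra.inclusion (by
    rintro _ ⟨u, hu, rfl⟩
    exact ⟨u, hu.mono fun x hx => hx.of_le hr, rfl⟩)

theorem toSmooth_injective (hr : ∞ ≤ r) :
    Function.Injective (toSmooth hr : FunGerm 𝕜 n r →ₐ[𝕜] FunGerm 𝕜 n ∞) :=
  Subalgebra.inclusion_injective _

theorem germDer_toSmooth (hr : ∞ ≤ r) (i : Fin n) (φ : FunGerm 𝕜 n r) :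
    germDer le_rfl i (toSmooth hr φ) = toSmooth hr (germDer hr i φ) := rfl

end GermLemmas

/-! ### Cohomology in degree zero -/

section Conclusion

variable {K F : Type*} [Field K] [CharZero K] [CommRing F] [Algebra K F] {n : ℕ}

theorem cohomology_zero_of_exists_eq_smul_pow [Nontrivial F] {D : Fin n → Derivation K F F} {f : F}
    (hker : ∀ g : F, (∀ i, D i g = 0) → ∃ c : K, g = algebraMap K F c)
    (hf : ∀ u, f * u = 0 → u = 0) (hfu : ¬ IsUnit f)
    (hpow : ∀ k : ℕ, ∀ g ∈ H0 D f (-k), ∃ c : K, g = c • f ^ k) :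
    (∀ p : ℤ, 0 < p → H0 D f p = ⊥) ∧
    (∀ p : ℤ, p ≤ 0 → H0 D f p = Submodule.span K {f ^ (-p).toNat}) ∧
    H0NP D f = Submodule.span K {1} ∧ Module.finrank K (H0NP D f) = 1 := by
  have hNP : H0NP D f = Submodule.span K {1} := by
    refine le_antisymm (fun g hg => ?_) ?_
    · obtain ⟨c, hc⟩ := hker g (partial_eq_zero_of_mem_H0NP hf hg)
      exact Submodule.mem_span_singleton.2 ⟨c, by rw [hc, Algebra.algebraMap_eq_smul_one]⟩
    · exact (Submodule.span_singleton_le_iff_mem _ _).2 one_mem_H0NP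
  refine ⟨fun p hp => H0_eq_bot_of_pos hker hf hfu hp, fun p hp => ?_, hNP, ?_⟩
  · obtain ⟨k, rfl⟩ : ∃ k : ℕ, p = -k := ⟨(-p).toNat, by omega⟩
    rw [neg_neg, Int.toNat_natCast]
    refine le_antisymm (fun g hg => ?_) ?_
    · obtain ⟨c, hc⟩ := hpow k g hg
      exact Submodule.mem_span_singleton.2 ⟨c, hc.symm⟩
    · exact (Submodule.span_singleton_le_iff_mem _ _).2 (pow_mem_H0 k)
  · rw [hNP]
    exact finrank_span_singleton one_ne_zero

/-- The cohomology in degree zero over a ring `F` of functions embedded, compatibly with the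
partial derivatives, in a reduced ring `F'` where two functions `ι x` and `ι y` vanishing at the base
point form a regular sequence. The division by `f` takes place in `F'`. -/
theorem cohomology_zero_of_regular_sequence {F' : Type*} [CommRing F'] [IsReduced F'] [Algebra K F']
    {D : Fin n → Derivation K F F} {D' : Fin n → Derivation K F' F'} (ι : F →ₐ[K] F')
    (hι : Function.Injective ι) (hD : ∀ i g, D' i (ι g) = ι (D i g))
    (hker : ∀ g : F', (∀ i, D' i g = 0) → ∃ c : K, g = algebraMap K F' c)
    (ε : F →ₐ[K] K) (hε : ∀ u, ε u ≠ 0 → IsUnit u) {x y : F} (hεx : ε x = 0) (hεy : ε y = 0)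
    (hx : ∀ a, ι x * a = 0 → a = 0) (hxy : ∀ a, ι x ∣ ι y * a → ι x ∣ a)
    {f : F} (hfin : FiniteCodim D f) (hf0 : ε f = 0) :
    (∀ p : ℤ, 0 < p → H0 D f p = ⊥) ∧
    (∀ p : ℤ, p ≤ 0 → H0 D f p = Submodule.span K {f ^ (-p).toNat}) ∧
    H0NP D f = Submodule.span K {1} ∧ Module.finrank K (H0NP D f) = 1 := by
  have : Nontrivial F := (ε : F →+* K).domain_nontrivial
  obtain ⟨N, hN⟩ := exists_pow_mem_jacobianIdeal hfin ε hε hεx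
  obtain ⟨M, hM⟩ := exists_pow_mem_jacobianIdeal hfin ε hε hεy
  replace hN := map_mem_jacobianIdeal hD hN
  replace hM := map_mem_jacobianIdeal hD hM
  rw [map_pow] at hN hM
  have hf := eq_zero_of_mul_eq_zero_of_pow_mem hx hN
  refine cohomology_zero_of_exists_eq_smul_pow (fun g hg => ?_) (fun u hu => hι ?_)
    (fun hu => (hu.map ε).ne_zero hf0) fun k g hg => ?_
  · obtain ⟨c, hc⟩ := hker (ι g) fun i => by rw [hD, hg, map_zero]
    exact ⟨c, hι (by rw [hc, AlgHom.commutes])⟩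
  · rw [map_zero]
    exact hf _ (by rw [← map_mul, hu, map_zero])
  · obtain ⟨c, hc⟩ := exists_eq_smul_pow_of_mem_H0 hker hf
      (dvd_of_forall_dvd_mul_partial hx hxy hf hN hM) k _ (map_mem_H0 hD hg)
    exact ⟨c, hι (by rw [hc, map_smul, map_pow])⟩

set_option maxHeartbeats 1000000 in
theorem cohomology_zero_funGerm {𝕜 : Type*} [RCLike 𝕜] {n : ℕ} {i j : Fin n} (hij : i ≠ j)
    {r : WithTop ℕ∞} (hr : ∞ ≤ r) (f : FunGerm 𝕜 n r) (hfin : FiniteCodim (germDer hr) f)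
    (hf0 : Germ.value f.1 = 0) :
    (∀ p : ℤ, 0 < p → H0 (germDer hr) f p = ⊥) ∧
    (∀ p : ℤ, p ≤ 0 → H0 (germDer hr) f p = Submodule.span 𝕜 {f ^ (-p).toNat}) ∧
    H0NP (germDer hr) f = Submodule.span 𝕜 {1} ∧ Module.finrank 𝕜 (H0NP (germDer hr) f) = 1 :=
  cohomology_zero_of_regular_sequence (F := FunGerm 𝕜 n r) (F' := FunGerm 𝕜 n ∞)
    (D := germDer hr) (D' := germDer le_rfl) (x := coordGerm i) (y := coordGerm j) (toSmooth hr)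
    (toSmooth_injective hr) (germDer_toSmooth hr) (funGerm_eq_const_of_partial_eq_zero le_rfl)
    valueAlgHom isUnit_of_valueAlgHom_ne_zero (valueAlgHom_coordGerm i) (valueAlgHom_coordGerm j)
    (eq_zero_of_coordGerm_mul_eq_zero i) (coordGerm_dvd_of_dvd_coordGerm_mul hij) hfin hf0

end Conclusion

end NambuPoisson

end

theorem mainTheorem6 (𝕜 : Type*) [RCLike 𝕜] (n : ℕ) (hn : 3 ≤ n) :
    -- germs at `0` of smooth (`r = ∞`) and of analytic (`r = ω`) functions on `𝕜ⁿ`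
    (∀ (r : WithTop ℕ∞) (hr : ∞ ≤ r) (f : NambuPoisson.FunGerm 𝕜 n r),
      NambuPoisson.FiniteCodim (NambuPoisson.germDer hr) f →
      Filter.Germ.value f.1 = 0 →
      (∀ p : ℤ, 0 < p → NambuPoisson.H0 (NambuPoisson.germDer hr) f p = ⊥) ∧
      (∀ p : ℤ, p ≤ 0 →
        NambuPoisson.H0 (NambuPoisson.germDer hr) f p =
          Submodule.span 𝕜 {f ^ (-p).toNat}) ∧
      NambuPoisson.H0NP (NambuPoisson.germDer hr) f = Submodule.span 𝕜 {1} ∧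
      Module.finrank 𝕜 (NambuPoisson.H0NP (NambuPoisson.germDer hr) f) = 1) ∧
    -- formal functions on `𝕜ⁿ`
    (∀ f : MvPowerSeries (Fin n) 𝕜,
      NambuPoisson.FiniteCodim (MvPowerSeries.pderiv 𝕜) f →
      MvPowerSeries.constantCoeff f = 0 →
      (∀ p : ℤ, 0 < p → NambuPoisson.H0 (MvPowerSeries.pderiv 𝕜) f p = ⊥) ∧
      (∀ p : ℤ, p ≤ 0 →
        NambuPoisson.H0 (MvPowerSeries.pderiv 𝕜) f p =
          Submodule.span 𝕜 {f ^ (-p).toNat}) ∧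
      NambuPoisson.H0NP (MvPowerSeries.pderiv 𝕜) f = Submodule.span 𝕜 {1} ∧
      Module.finrank 𝕜 (NambuPoisson.H0NP (MvPowerSeries.pderiv 𝕜) f) = 1) := by
  have hij : (⟨0, by omega⟩ : Fin n) ≠ ⟨1, by omega⟩ := by simp
  refine ⟨fun r hr f hfin hf0 => ?_, fun f hfin hf0 => ?_⟩
  · exact NambuPoisson.cohomology_zero_funGerm hij hr f hfin hf0
  · exact NambuPoisson.cohomology_zero_of_regular_sequence (AlgHom.id 𝕜 _)
      Function.injective_id (fun _ _ => rfl)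
      NambuPoisson.powerSeries_eq_const_of_pderiv_eq_zero NambuPoisson.constantCoeffAlgHom
      (fun u hu => MvPowerSeries.isUnit_iff_constantCoeff.2 (IsUnit.mk0 _ hu))
      (MvPowerSeries.constantCoeff_X _) (MvPowerSeries.constantCoeff_X _)
      (fun a h => MvPowerSeries.X_mem_nonzeroDivisors.1 a h)
      (NambuPoisson.powerSeries_X_dvd_of_X_dvd_X_mul hij) hfin hf0
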